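/- Consider a set of potential bidders. In procurement $t$ the set of participating bidders is $\mathcal I_t$, with $|\mathcal I_t|\ge 2$. Entry is exogenous: $\mathcal I_t$ is drawn independently of the costs and of the unobserved heterogeneity below. Assume: (1) the private costs $c_{it}$ are independent; $c_{it}$ has distribution $F_i$ with a density that is positive on its support, a common interval $[\underline c,\overline c]\subset\mathbb R_+$ (not assumed known); (2) bidder $i$ has CRRA utility $U_i(\xi)=\xi^{1-\eta_i}$, $\xi\ge 0$, with $\eta_i\in[0,1)$; (3) the unobserved heterogeneity $u_t$ is i.i.d. with distribution $F_u$, which has a density that is positive on its support $[\underline u,\overline u]\subset\mathbb R_+$, where $\overline u$ is known; $u_t$ is independent of the vector of costs; and the final cost of bidder $i$ is $u_t c_{it}$. The lowest bid wins and is the price, and a losing bidder has utility $0$. For every bidder set $\mathcal I$ that occurs with positive probability, let $\{\beta_i(\cdot|\mathcal I)\}_{i\in\mathcal I}$ be a Bayesian Nash equilibrium of the first-price procurement with $u_t=1$ in strictly increasing continuous strategies with $\beta_i(\overline c|\mathcal I)=\overline c$; that is, for every $c\in[\underline c,\overline c]$ the bid $\beta_i(c|\mathcal I)\ge c$ maximizes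 $(b-c)^{1-\eta_i}\prod_{j\in\mathcal I\setminus\{i\}}\Pr(\beta_j(c_j|\mathcal I)>b)$ over $b\ge c$. In procurement $t$ bidder $i\in\mathcal I_t$ bids $b_{it}=u_t\,\beta_i(c_{it}|\mathcal I_t)$ (these bids form an equilibrium of the procurement with costs multiplied by $u_t$). Suppose that every potential bidder participates with strictly positive probability, and that the bidder set varies in the sense that some set $\mathcal I$ and some strictly larger set $\mathcal I'\supsetneq\mathcal I$ both occur with positive probability. Then all $F_i$, all $\eta_i$ and $F_u$ are identified from the submitted bids and the bidder configurations: if two models of this kind with the same $\overline u$, one of which satisfies the two entry conditions of this paragraph, generate the same joint law of $(\mathcal I_t,(b_{it})_{i\in\mathcal I_t})$, then they have the same $F_i$ and the same $\eta_i$ for every potential bidder $i$, and the same $F_u$. -/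

import Mathlib

open MeasureTheory Set
open scoped ENNReal

noncomputable section

/-- `μ` is a probability measure on `ℝ` with a density that is positive on its support `[a, b]`
(and zero outside). -/
def HasPositiveDensityOn (μ : Measure ℝ) (a b : ℝ) : Prop :=
  IsProbabilityMeasure μ ∧ ∃ f : ℝ → ℝ, Measurable f ∧ (∀ x ∈ Icc a b, 0 < f x) ∧
    μ = (volume.restrict (Icc a b)).withDensity (fun x => ENNReal.ofReal (f x))

/-- CRRA utility `ξ ↦ ξ ^ (1 - η)`, used only for consumption `ξ ≥ 0`. -/
def crra (η ξ : ℝ) : ℝ := ξ ^ (1 - η)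

section Game

variable {ι : Type*} [DecidableEq ι]

/-- The probability that the bid `b` of bidder `i` is below the bids of all other bidders in `I`,
when bidder `j` has a cost with law `F j`, independent of the other costs, and uses the bidding
strategy `β j`. For `b` in the range of the strictly increasing `β j`, the factor of `j` is
`1 - F_j (β_j⁻¹ b)`. -/
def winProb (F : ι → Measure ℝ) (I : Finset ι) (β : ι → ℝ → ℝ) (i : ι) (b : ℝ) : ℝ :=
  ∏ j ∈ I.erase i, (F j).real {c | b < β j c}

/-- Expected utility of bidder `i` with cost `c` who bids `b ≥ c`. A losing bidder gets `0`, and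
ties have probability zero because the strategies considered are strictly increasing and the cost
laws have densities. -/
def expectedUtility (F : ι → Measure ℝ) (η : ι → ℝ) (I : Finset ι) (β : ι → ℝ → ℝ)
    (i : ι) (c b : ℝ) : ℝ :=
  crra (η i) (b - c) * winProb F I β i b

/-- Bayesian Nash equilibrium of the first-price procurement among the bidders in `I` with costs
in `[lo, hi]`, in strictly increasing continuous strategies with the boundary condition
`β_i(hi) = hi`: bidding `β_i(c)` maximizes the expected utility of every bidder `i` at every
cost `c`, over all bids for which the utility is defined, that is `b ≥ c`. -/
structure IsEquilibrium (F : ι → Measure ℝ) (η : ι → ℝ) (lo hi : ℝ) (I : Finset ι)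
    (β : ι → ℝ → ℝ) : Prop where
  strictMono : ∀ i ∈ I, StrictMonoOn (β i) (Icc lo hi)
  continuous : ∀ i ∈ I, ContinuousOn (β i) (Icc lo hi)
  top : ∀ i ∈ I, β i hi = hi
  cost_le : ∀ i ∈ I, ∀ c ∈ Icc lo hi, c ≤ β i c
  best : ∀ i ∈ I, ∀ c ∈ Icc lo hi, ∀ b, c ≤ b →
    expectedUtility F η I β i c b ≤ expectedUtility F η I β i c (β i c)

/-- The strategy, as a function of the final cost `c°`, in a procurement with heterogeneity `u`,
when `β` is the strategy for `u = 1`: `β°(c°) = u β(c° / u)`, that is `β°(u c) = u β(c)`. -/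
def scaledStrategy (u : ℝ) (β : ℝ → ℝ) (c : ℝ) : ℝ := u * β (c / u)

/-- The scaled strategies form an equilibrium of the procurement in which every cost is multiplied
by `u`. -/
theorem IsEquilibrium.scaled {F : ι → Measure ℝ} {η : ι → ℝ} {lo hi : ℝ} {I : Finset ι}
    {β : ι → ℝ → ℝ} (h : IsEquilibrium F η lo hi I β) {u : ℝ} (hu : 0 < u) :
    IsEquilibrium (fun i => (F i).map (fun c => u * c)) η (u * lo) (u * hi) I
      (fun i => scaledStrategy u (β i)) := by
  have hu' : u ≠ 0 := hu.ne'
  have hmem : ∀ c ∈ Icc (u * lo) (u * hi), c / u ∈ Icc lo hi := by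
    rintro c ⟨h1, h2⟩
    constructor
    · rw [le_div_iff₀ hu]; linarith
    · rw [div_le_iff₀ hu]; linarith
  have hwin : ∀ i b, winProb (fun i => (F i).map (fun c => u * c)) I
      (fun i => scaledStrategy u (β i)) i b = winProb F I β i (b / u) := by
    intro i b
    unfold winProb
    refine Finset.prod_congr rfl fun j _ => ?_
    have e : (fun c : ℝ => u * c) = MeasurableEquiv.mulLeft₀ u hu' := rfl
    rw [Measure.real, Measure.real, e, MeasurableEquiv.map_apply]
    congr 2
    ext c
    simp [scaledStrategy, mul_div_cancel_left₀, hu', div_lt_iff₀ hu, mul_comm]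
  have hU : ∀ i c b, c ≤ b → expectedUtility (fun i => (F i).map (fun c => u * c)) η I
      (fun i => scaledStrategy u (β i)) i c b
      = u ^ (1 - η i) * expectedUtility F η I β i (c / u) (b / u) := by
    intro i c b hcb
    have h1 : b - c = u * (b / u - c / u) := by field_simp
    have h2 : 0 ≤ b / u - c / u := by
      rw [← sub_div]; exact div_nonneg (by linarith) hu.le
    unfold expectedUtility crra
    rw [hwin, h1, Real.mul_rpow hu.le h2]
    ring
  refine ⟨?_, ?_, ?_, ?_, ?_⟩
  · intro i hi c hc d hd hcd
    have := h.strictMono i hi (hmem c hc) (hmem d hd) (by gcongr)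
    unfold scaledStrategy
    gcongr
  · intro i hi
    exact continuousOn_const.mul
      ((h.continuous i hi).comp (by fun_prop) (fun c hc => hmem c hc))
  · intro i hi
    simp [scaledStrategy, hu', h.top i hi]
  · intro i hi c hc
    have := h.cost_le i hi _ (hmem c hc)
    rw [div_le_iff₀ hu] at this
    unfold scaledStrategy
    linarith
  · intro i hi c hc b hcb
    have h1 := h.cost_le i hi _ (hmem c hc)
    have h2 : c ≤ scaledStrategy u (β i) c := by
      rw [div_le_iff₀ hu] at h1
      unfold scaledStrategy
      linarith
    rw [hU i c b hcb, hU i c _ h2]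
    have h3 : scaledStrategy u (β i) c / u = β i (c / u) := by
      unfold scaledStrategy; field_simp
    rw [h3]
    refine mul_le_mul_of_nonneg_left (h.best i hi _ (hmem c hc) _ ?_) (Real.rpow_nonneg hu.le _)
    gcongr

end Game

/-- The model: a structure that may have generated the data. The upper end `uHi` of the support of
the unobserved heterogeneity is known (the location normalization); all other components,
including the common support `[lo, hi]` of the costs, are unknown to the researcher. -/
structure ProcurementModel (ι : Type*) [DecidableEq ι] (uHi : ℝ) where
  /-- lower end of the common support of the costs -/
  lo : ℝ
  /-- upper end of the common support of the costs -/
  hi : ℝ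
  /-- cost distributions -/
  F : ι → Measure ℝ
  /-- CRRA coefficients -/
  η : ι → ℝ
  /-- lower end of the support of the unobserved heterogeneity -/
  uLo : ℝ
  /-- distribution of the unobserved heterogeneity -/
  Fu : Measure ℝ
  /-- law of the bidder configuration `I_t` -/
  config : PMF (Finset ι)
  /-- `β I i c` is the equilibrium bid of bidder `i` with cost `c` in the procurement with bidder
  set `I` and no heterogeneity (`u = 1`) -/
  β : Finset ι → ι → ℝ → ℝ
  lo_nonneg : 0 ≤ lo
  F_density : ∀ i, HasPositiveDensityOn (F i) lo hi
  η_mem : ∀ i, η i ∈ Ico (0 : ℝ) 1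
  uLo_nonneg : 0 ≤ uLo
  Fu_density : HasPositiveDensityOn Fu uLo uHi
  two_le_card : ∀ I ∈ config.support, 2 ≤ I.card
  equilibrium : ∀ I ∈ config.support, IsEquilibrium F η lo hi I (β I)

namespace ProcurementModel

variable {ι : Type*} [DecidableEq ι] {uHi : ℝ}

/-- Joint law of all submitted bids in a procurement with bidder set `I`: the heterogeneity `u` and
the costs `c_i` are jointly independent with laws `Fu` and `F i`, the final cost of bidder `i` is
`u c_i`, and she bids according to her strategy for final costs. -/
def bidLaw (M : ProcurementModel ι uHi) (I : Finset ι) : Measure (I → ℝ) :=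
  (M.Fu.prod (Measure.pi fun i : I => M.F i)).map
    (fun ω i => scaledStrategy ω.1 (M.β I i) (ω.1 * ω.2 i))

/-- Law of one observation, consisting of the bidder configuration and of all submitted bids. The
configuration is exogenous: it is drawn independently of the heterogeneity and the costs. -/
def dataLaw (M : ProcurementModel ι uHi) : Measure (Σ I : Finset ι, (I → ℝ)) :=
  Measure.sum fun I => M.config I • (M.bidLaw I).map (Sigma.mk I)

/-- The probability that bidder `i` enters. -/
def entryProb (M : ProcurementModel ι uHi) (i : ι) : ℝ≥0∞ :=
  M.config.toOuterMeasure {I | i ∈ I}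

/-- The bidder configuration varies: some bidder set and a strictly larger one both occur with
positive probability. -/
def ConfigVaries (M : ProcurementModel ι uHi) : Prop :=
  ∃ I J : Finset ι, I ⊂ J ∧ 0 < M.config I ∧ 0 < M.config J

end ProcurementModel

end

/-!
The heterogeneity is removed by deconvolution, and the resulting laws of homogeneous bids are
inverted by means of the first-order condition.

Deconvolution. A bid is `u a_i` with `u` the heterogeneity and `a_i = β_i(c_i)`, so the mixed moments
of two bids are `E[u ^ (s + t)] E[a_i ^ s] E[a_j ^ t]` (`integral_bidLaw_pow_mul_pow`). If two models
generate the same bids, the ratio of their moments of `u` is therefore a multiplicative function of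
the exponent (`exists_geometric_ratio`). As everything is bounded, moments determine laws
(`Measure.ext_of_moments`), so the laws of `u` agree up to scale. The known upper end of the support
fixes the scale (`Fu_eq`), and then the laws of the `a_i` agree too (`homogeneousBidLaw_eq`). Working
with moments rather than characteristic functions of logarithms needs no condition on zeros, and
allows the supports to reach down to `0`.

Inversion. The laws of the `a_i` determine the winning probability `W_i`, and they match each cost
`c` in one model with the cost `c'` at the same quantile in the other, in the same way for all bidder
sets (`β_eq_iff`). Optimality of the common bid `b` in both models forces
`(1 - η_i) / (b - c) = (1 - η_i') / (b - c')` (`IsEquilibrium.div_markup_eq`). The densities need not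
be continuous, so `W_i` is not assumed differentiable; revealed preference inequalities replace its
derivative. Hence a bidder whose bid at some cost differs between two bidder sets has `η_i = η_i'`
(`η_eq_of_β_ne`), and when a bidder set grows there is such a bidder
(`IsEquilibrium.exists_ne_of_ssubset`, an envelope argument). This bidder then has the same cost
distribution in both models, so that the lower end of the common support is identified. At that cost
the first-order condition identifies the risk aversion of every other bidder (`η_eq_of_lo_eq`), and
with it all remaining cost distributions (`F_eq_of_η_eq`).
-/

open Filter Topology

/-! ### Laws with a positive density on an interval, and moments -/

namespace HasPositiveDensityOn

variable {μ ν : Measure ℝ} {a b : ℝ}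

theorem isProbabilityMeasure (h : HasPositiveDensityOn μ a b) : IsProbabilityMeasure μ := h.1

theorem ae_mem_Icc (h : HasPositiveDensityOn μ a b) : ∀ᵐ x ∂μ, x ∈ Icc a b := by
  obtain ⟨-, f, -, -, rfl⟩ := h
  exact withDensity_absolutelyContinuous _ _ (ae_restrict_mem measurableSet_Icc)

theorem absolutelyContinuous (h : HasPositiveDensityOn μ a b) : μ ≪ volume := by
  obtain ⟨-, f, -, -, rfl⟩ := h
  exact (withDensity_absolutelyContinuous _ _).trans Measure.restrict_le_self.absolutelyContinuous

theorem lt (h : HasPositiveDensityOn μ a b) : a < b := by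
  by_contra! hab
  have := h.isProbabilityMeasure
  have h1 : μ (Icc a b) = 0 := h.absolutelyContinuous (by simp [hab])
  have h2 : μ (Icc a b) = 1 := (mem_ae_iff_prob_eq_one measurableSet_Icc).1 h.ae_mem_Icc
  simp [h1] at h2

/-- Every set that contains a nondegenerate open interval inside the support has positive mass. No
measurability of the set is needed, so this also serves for sets cut out by a strategy, which is
unrestricted off the support. -/
theorem pos_of_Ioo_subset (h : HasPositiveDensityOn μ a b) {x y : ℝ} (hax : a ≤ x) (hxy : x < y)
    (hyb : y ≤ b) {s : Set ℝ} (hs : Ioo x y ⊆ s) : 0 < μ s := by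
  refine lt_of_lt_of_le ?_ (measure_mono hs)
  obtain ⟨-, f, hf, hpos, rfl⟩ := h
  refine pos_iff_ne_zero.2 fun h0 => ?_
  have hac : volume.restrict (Icc a b) ≪
      (volume.restrict (Icc a b)).withDensity (fun x => ENNReal.ofReal (f x)) := by
    refine withDensity_absolutelyContinuous' hf.ennreal_ofReal.aemeasurable ?_
    filter_upwards [ae_restrict_mem measurableSet_Icc] with z hz
    simpa using hpos z hz
  have h1 := hac h0
  rw [Measure.restrict_apply measurableSet_Ioo, inter_eq_left.2
    (Ioo_subset_Icc_self.trans (Icc_subset_Icc hax hyb))] at h1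
  simp at h1
  linarith

theorem real_pos_of_Ioo_subset (h : HasPositiveDensityOn μ a b) {x y : ℝ} (hax : a ≤ x)
    (hxy : x < y) (hyb : y ≤ b) {s : Set ℝ} (hs : Ioo x y ⊆ s) : 0 < μ.real s :=
  have := h.isProbabilityMeasure
  ENNReal.toReal_pos (h.pos_of_Ioo_subset hax hxy hyb hs).ne' (measure_ne_top _ _)

/-- The law determines the lower end of its support. -/
theorem left_endpoint_eq {b' a' : ℝ} (h : HasPositiveDensityOn μ a b)
    (h' : HasPositiveDensityOn μ a' b') : a = a' := by
  by_contra hne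
  wlog hlt : a < a' generalizing a a' b b'
  · exact this h' h (Ne.symm hne) (lt_of_le_of_ne (not_lt.1 hlt) (Ne.symm hne))
  have h1 : 0 < μ (Iio a') :=
    h.pos_of_Ioo_subset le_rfl (lt_min hlt h.lt) (min_le_right _ _) fun x hx =>
      hx.2.trans_le (min_le_left _ _)
  have h2 : μ (Iio a') = 0 := measure_mono_null (fun x hx => by simp_all) h'.ae_mem_Icc
  exact h1.ne' h2

/-- Two laws whose supports have the same positive right endpoint and which agree up to scale are
scaled by the factor `1`. -/
theorem scale_eq_one {t a' κ : ℝ} (h : HasPositiveDensityOn μ a t)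
    (h' : HasPositiveDensityOn ν a' t) (ht : 0 < t) (hκ : 0 < κ)
    (hν : ν = μ.map (fun x => κ * x)) : κ = 1 := by
  have key : ∀ s, ν (Ioi s) = μ (Ioi (s / κ)) := by
    intro s
    rw [hν, Measure.map_apply (by fun_prop) measurableSet_Ioi]
    congr 1
    ext x
    simp [div_lt_iff₀ hκ, mul_comm]
  have zero : ∀ {ρ : Measure ℝ} {r s : ℝ}, HasPositiveDensityOn ρ r t → t ≤ s →
      ρ (Ioi s) = 0 := fun hρ hs =>
    measure_mono_null (fun x hx => by
      simp only [mem_Ioi, mem_compl_iff, Set.mem_ofPred_eq, mem_Icc, not_and, not_le] at *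
      intro; linarith) hρ.ae_mem_Icc
  have pos : ∀ {ρ : Measure ℝ} {r s : ℝ}, HasPositiveDensityOn ρ r t → s < t →
      0 < ρ (Ioi s) := fun hρ hs =>
    hρ.pos_of_Ioo_subset (le_max_left _ _) (max_lt hρ.lt hs) le_rfl
      fun x hx => (le_max_right _ _).trans_lt hx.1
  rcases lt_trichotomy κ 1 with hlt | heq | hgt
  · have h1 := pos h' (s := κ * t) (by nlinarith)
    rw [key, mul_div_cancel_left₀ _ hκ.ne', zero h le_rfl] at h1
    exact absurd h1 (lt_irrefl _)
  · exact heq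
  · have h1 := key t
    rw [zero h' le_rfl] at h1
    exact absurd h1.symm (pos h (div_lt_self ht hgt)).ne'

end HasPositiveDensityOn

/-- The Hausdorff moment problem is determinate: a finite measure on a bounded interval is
determined by its moments. -/
theorem MeasureTheory.Measure.ext_of_moments {μ ν : Measure ℝ} [IsFiniteMeasure μ]
    [IsFiniteMeasure ν] {a b : ℝ} (hμ : ∀ᵐ x ∂μ, x ∈ Icc a b) (hν : ∀ᵐ x ∂ν, x ∈ Icc a b)
    (h : ∀ n : ℕ, ∫ x, x ^ n ∂μ = ∫ x, x ^ n ∂ν) : μ = ν := by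
  have hint : ∀ (ρ : Measure ℝ) [IsFiniteMeasure ρ], (∀ᵐ x ∂ρ, x ∈ Icc a b) →
      ∀ f : ℝ → ℝ, Continuous f → Integrable f ρ := by
    intro ρ _ hρ f hf
    obtain ⟨C, hC⟩ := isCompact_Icc.exists_bound_of_continuousOn (hf.continuousOn (s := Icc a b))
    exact Integrable.of_bound hf.aestronglyMeasurable C (hρ.mono hC)
  have hpoly : ∀ p : Polynomial ℝ, ∫ x, p.eval x ∂μ = ∫ x, p.eval x ∂ν := by
    intro p
    simp only [Polynomial.eval_eq_sum_range]
    rw [integral_finsetSum _ fun i _ => hint μ hμ _ (by fun_prop),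
      integral_finsetSum _ fun i _ => hint ν hν _ (by fun_prop)]
    simp only [integral_const_mul, h]
  refine ext_of_forall_integral_eq_of_IsFiniteMeasure fun f => ?_
  have hclose : ∀ ε > 0, |∫ x, f x ∂μ - ∫ x, f x ∂ν| ≤ ε * (μ.real univ + ν.real univ) := by
    intro ε hε
    obtain ⟨p, hp⟩ := exists_polynomial_near_of_continuousOn a b f f.continuous.continuousOn ε hε
    have hone : ∀ (ρ : Measure ℝ) [IsFiniteMeasure ρ], (∀ᵐ x ∂ρ, x ∈ Icc a b) →
        |∫ x, f x ∂ρ - ∫ x, p.eval x ∂ρ| ≤ ε * ρ.real univ := by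
      intro ρ _ hρ
      rw [← integral_sub (hint ρ hρ _ f.continuous) (hint ρ hρ _ p.continuous)]
      have hbd : ∀ᵐ x ∂ρ, ‖f x - p.eval x‖ ≤ ε := hρ.mono fun x hx => by
        rw [Real.norm_eq_abs, abs_sub_comm]
        exact (hp x hx).le
      exact norm_integral_le_of_norm_le_const hbd
    have h1 := hone μ hμ
    have h2 := hone ν hν
    rw [hpoly] at h1
    rw [abs_le] at *
    constructor <;> linarith
  have hS : 0 ≤ μ.real univ + ν.real univ := by positivity
  rw [← sub_eq_zero, ← abs_eq_zero]
  refine le_antisymm (le_of_forall_pos_le_add fun ε hε => ?_) (abs_nonneg _)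
  refine (hclose (ε / (μ.real univ + ν.real univ + 1)) (by positivity)).trans ?_
  rw [zero_add, div_mul_eq_mul_div, div_le_iff₀ (by positivity)]
  nlinarith

/-- Multiplicative deconvolution: if `m (s + t) * A s * B t` does not change when the positive
sequences `m`, `A`, `B` are replaced by `m'`, `A'`, `B'`, then the ratio `m' / m` is multiplicative,
hence geometric. -/
theorem exists_geometric_ratio {m m' A A' B B' : ℕ → ℝ} (hm : ∀ n, 0 < m n) (hm' : ∀ n, 0 < m' n)
    (hA : ∀ n, 0 < A n) (hB : ∀ n, 0 < B n)
    (hm0 : m 0 = 1) (hm0' : m' 0 = 1) (hA0 : A 0 = 1) (hA0' : A' 0 = 1) (hB0 : B 0 = 1)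
    (hB0' : B' 0 = 1) (h : ∀ s t, m (s + t) * (A s * B t) = m' (s + t) * (A' s * B' t)) :
    ∃ κ > 0, ∀ n, m' n = κ ^ n * m n := by
  have h1 : ∀ s, m s * A s = m' s * A' s := fun s => by simpa [hB0, hB0'] using h s 0
  have h2 : ∀ t, m t * B t = m' t * B' t := fun t => by simpa [hA0, hA0'] using h 0 t
  have hmul : ∀ s t, m' (s + t) / m (s + t) = m' s / m s * (m' t / m t) := by
    intro s t
    have e1 : A' s = m s * A s / m' s := by rw [h1 s, mul_div_cancel_left₀ _ (hm' s).ne']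
    have e2 : B' t = m t * B t / m' t := by rw [h2 t, mul_div_cancel_left₀ _ (hm' t).ne']
    have e3 := h s t
    rw [e1, e2] at e3
    have := hm s; have := hm t; have := hm (s + t); have := hm' s; have := hm' t
    have := hA s; have := hB t
    field_simp at e3 ⊢
    linarith
  refine ⟨m' 1 / m 1, div_pos (hm' 1) (hm 1), fun n => ?_⟩
  rw [← div_eq_iff (hm n).ne']
  induction n with
  | zero => simp [hm0, hm0']
  | succ n ih => rw [hmul, ih, pow_succ]

theorem MeasureTheory.integral_pow_pos_of_ae_mem_Ioc {α : Type*} [MeasurableSpace α]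
    {μ : Measure α} [IsProbabilityMeasure μ] {f : α → ℝ} {b : ℝ} (hf : AEMeasurable f μ)
    (h : ∀ᵐ x ∂μ, f x ∈ Ioc 0 b) (n : ℕ) : 0 < ∫ x, f x ^ n ∂μ := by
  have hpos : ∀ᵐ x ∂μ, 0 < f x ^ n := h.mono fun x hx => pow_pos hx.1 n
  rw [integral_pos_iff_support_of_nonneg_ae (hpos.mono fun x hx => hx.le)]
  · refine pos_iff_ne_zero.2 fun h0 => ?_
    have hfalse : ∀ᵐ _ ∂μ, False := by
      filter_upwards [hpos, measure_eq_zero_iff_ae_notMem.1 h0] with x hx hx'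
      exact hx' hx.ne'
    exact IsProbabilityMeasure.ne_zero μ (by simpa using hfalse)
  · refine Integrable.of_bound (hf.pow_const n).aestronglyMeasurable (b ^ n) (h.mono fun x hx => ?_)
    rw [Real.norm_of_nonneg (pow_nonneg hx.1.le n)]
    exact pow_le_pow_left₀ hx.1.le hx.2 n

/-! ### Removing the unobserved heterogeneity -/

namespace ProcurementModel

variable {ι : Type*} [DecidableEq ι] {uHi : ℝ}

instance (M : ProcurementModel ι uHi) (i : ι) : IsProbabilityMeasure (M.F i) :=
  (M.F_density i).isProbabilityMeasure

instance (M : ProcurementModel ι uHi) : IsProbabilityMeasure M.Fu :=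
  M.Fu_density.isProbabilityMeasure

/-- Law of the bid of bidder `i` in the bidder set `I` when there is no heterogeneity (`u = 1`). -/
noncomputable def homogeneousBidLaw (M : ProcurementModel ι uHi) (I : Finset ι) (i : ι) : Measure ℝ :=
  (M.F i).map (M.β I i)

variable {M M' : ProcurementModel ι uHi} {I : Finset ι} {i : ι}

theorem lo_lt_hi (M : ProcurementModel ι uHi) (i : ι) : M.lo < M.hi := (M.F_density i).lt

theorem aemeasurable_β (hI : I ∈ M.config.support) (hi : i ∈ I) :
    AEMeasurable (M.β I i) (M.F i) := by
  -- Nothing is known about the strategy off the support of the cost law.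
  rw [← Measure.restrict_eq_self_of_ae_mem (M.F_density i).ae_mem_Icc]
  exact ((M.equilibrium I hI).continuous i hi).aemeasurable measurableSet_Icc

theorem lo_lt_β (hI : I ∈ M.config.support) (hi : i ∈ I) {c : ℝ} (hc : c ∈ Ioc M.lo M.hi) :
    M.lo < M.β I i c :=
  hc.1.trans_le ((M.equilibrium I hI).cost_le i hi c ⟨hc.1.le, hc.2⟩)

theorem β_le_hi (hI : I ∈ M.config.support) (hi : i ∈ I) {c : ℝ} (hc : c ∈ Icc M.lo M.hi) :
    M.β I i c ≤ M.hi := by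
  have hE := M.equilibrium I hI
  rw [← hE.top i hi]
  exact (hE.strictMono i hi).monotoneOn hc (right_mem_Icc.2 (M.lo_lt_hi i).le) hc.2

theorem ae_β_mem (hI : I ∈ M.config.support) (hi : i ∈ I) :
    ∀ᵐ c ∂M.F i, M.β I i c ∈ Ioc 0 M.hi := by
  have hlo : ∀ᵐ c ∂M.F i, c ≠ M.lo := (M.F_density i).absolutelyContinuous (by simp)
  filter_upwards [(M.F_density i).ae_mem_Icc, hlo] with c hc hc'
  exact ⟨M.lo_nonneg.trans_lt (lo_lt_β hI hi ⟨lt_of_le_of_ne hc.1 (Ne.symm hc'), hc.2⟩),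
    β_le_hi hI hi hc⟩

theorem ae_heterogeneity_mem (M : ProcurementModel ι uHi) : ∀ᵐ u ∂M.Fu, u ∈ Ioc 0 uHi := by
  have hlo : ∀ᵐ c ∂M.Fu, c ≠ M.uLo := M.Fu_density.absolutelyContinuous (by simp)
  filter_upwards [M.Fu_density.ae_mem_Icc, hlo] with c hc hc'
  exact ⟨M.uLo_nonneg.trans_lt (lt_of_le_of_ne hc.1 (Ne.symm hc')), hc.2⟩

/-- The bid on the final cost `u c` is `u β(c)`, also for `u = 0`, where `c / u` is a junk value. -/
theorem scaledStrategy_mul (u c : ℝ) (β : ℝ → ℝ) : scaledStrategy u β (u * c) = u * β c := by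
  rcases eq_or_ne u 0 with rfl | hu
  · simp [scaledStrategy]
  · rw [scaledStrategy, mul_div_cancel_left₀ _ hu]

theorem aemeasurable_bids (hI : I ∈ M.config.support) :
    AEMeasurable (fun (ω : ℝ × (I → ℝ)) (i : I) =>
      scaledStrategy ω.1 (M.β I i) (ω.1 * ω.2 i)) (M.Fu.prod (Measure.pi fun i : I => M.F i)) := by
  simp only [scaledStrategy_mul]
  refine aemeasurable_pi_lambda _ fun k => measurable_fst.aemeasurable.mul ?_
  exact (aemeasurable_β hI k.2).comp_quasiMeasurePreserving
    ((Measure.quasiMeasurePreserving_eval (fun i : I => M.F i) k).comp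
      Measure.quasiMeasurePreserving_snd)

theorem isProbabilityMeasure_bidLaw (hI : I ∈ M.config.support) :
    IsProbabilityMeasure (M.bidLaw I) :=
  Measure.isProbabilityMeasure_map (aemeasurable_bids hI)

theorem integral_bidLaw_prod_pow (hI : I ∈ M.config.support) (e : I → ℕ) :
    ∫ x, ∏ k, x k ^ e k ∂M.bidLaw I
      = (∫ u, u ^ (∑ k, e k) ∂M.Fu) * ∏ k : I, ∫ c, M.β I k c ^ e k ∂M.F k := by
  rw [bidLaw, integral_map (aemeasurable_bids hI)
    (Continuous.aestronglyMeasurable (by fun_prop)),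
    ← integral_fintype_prod_eq_prod (fun (k : I) c => M.β I k c ^ e k), ← integral_prod_mul]
  refine integral_congr_ae (Filter.Eventually.of_forall fun ω => ?_)
  simp only [scaledStrategy_mul, mul_pow, Finset.prod_mul_distrib, Finset.prod_pow_eq_pow_sum]

/-- Restricting the law of one observation to a bidder set recovers its bid law, up to the
probability of that bidder set. -/
theorem dataLaw_apply_image (M : ProcurementModel ι uHi) (I : Finset ι) {s : Set (I → ℝ)}
    (hs : MeasurableSet s) : M.dataLaw (Sigma.mk I '' s) = M.config I * M.bidLaw I s := by
  -- Naming the fibre family lets the elaborator find it in `Sigma.mk`.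
  let B : Finset ι → Type _ := fun I => I → ℝ
  have hmeas : ∀ J : Finset ι, Measurable (Sigma.mk (β := B) J) :=
    fun J _ ht => MeasurableSpace.measurableSet_iInf.1 ht J
  have hpre : ∀ J : Finset ι, J ≠ I →
      Sigma.mk (β := B) J ⁻¹' (Sigma.mk (β := B) I '' s) = ∅ := by
    intro J hJ
    ext x
    simp only [mem_preimage, mem_image, Sigma.mk.injEq, mem_empty_iff_false, iff_false, not_exists,
      not_and]
    intro y _ h _
    exact hJ h.symm
  have hself : Sigma.mk (β := B) I ⁻¹' (Sigma.mk (β := B) I '' s) = s :=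
    preimage_image_eq _ sigma_mk_injective
  have himg : MeasurableSet (Sigma.mk (β := B) I '' s) := by
    refine MeasurableSpace.measurableSet_iInf.2 fun J => ?_
    change MeasurableSet (Sigma.mk (β := B) J ⁻¹' (Sigma.mk (β := B) I '' s))
    rcases eq_or_ne J I with rfl | hJ
    · rwa [hself]
    · rw [hpre J hJ]; exact MeasurableSet.empty
  rw [dataLaw, Measure.sum_apply _ himg, tsum_eq_single I]
  · rw [Measure.smul_apply, Measure.map_apply (hmeas I) himg, hself, smul_eq_mul]
  · intro J hJ
    rw [Measure.smul_apply, Measure.map_apply (hmeas J) himg, hpre J hJ]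
    simp

theorem mem_support_of_dataLaw_eq (h : M.dataLaw = M'.dataLaw) (hI : I ∈ M.config.support) :
    I ∈ M'.config.support := by
  have := isProbabilityMeasure_bidLaw hI
  have h1 := dataLaw_apply_image M I MeasurableSet.univ
  rw [measure_univ, mul_one, h, dataLaw_apply_image M' I MeasurableSet.univ] at h1
  rw [PMF.mem_support_iff] at hI ⊢
  intro h0
  rw [h0, zero_mul] at h1
  exact hI h1.symm

theorem bidLaw_eq_of_dataLaw_eq (h : M.dataLaw = M'.dataLaw) (hI : I ∈ M.config.support) :
    M.bidLaw I = M'.bidLaw I := by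
  have hI' := mem_support_of_dataLaw_eq h hI
  have := isProbabilityMeasure_bidLaw hI
  have := isProbabilityMeasure_bidLaw hI'
  have key : ∀ s : Set (I → ℝ), MeasurableSet s →
      M.config I * M.bidLaw I s = M'.config I * M'.bidLaw I s := fun s hs => by
    rw [← dataLaw_apply_image M I hs, h, dataLaw_apply_image M' I hs]
  have hc : M.config I = M'.config I := by simpa using key univ MeasurableSet.univ
  ext s hs
  have := key s hs
  rw [hc] at this
  exact (ENNReal.mul_right_inj ((PMF.mem_support_iff _ _).1 hI') (PMF.apply_ne_top _ _)).1 this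

/-- The mixed moments of two bids separate the heterogeneity from the homogeneous bids. -/
theorem integral_bidLaw_pow_mul_pow (hI : I ∈ M.config.support) {i j : I} (hij : i ≠ j) (s t : ℕ) :
    ∫ x, x i ^ s * x j ^ t ∂M.bidLaw I = (∫ u, u ^ (s + t) ∂M.Fu) *
      ((∫ c, M.β I i c ^ s ∂M.F i) * ∫ c, M.β I j c ^ t ∂M.F j) := by
  have hprod : ∀ g : I → ℕ → ℝ, (∀ k, g k 0 = 1) →
      ∏ k, g k ((Pi.single i s + Pi.single j t : I → ℕ) k) = g i s * g j t := by
    intro g hg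
    rw [← Finset.prod_subset (Finset.subset_univ {i, j}), Finset.prod_pair hij]
    · simp [hij, hij.symm]
    · intro k _ hk
      simp only [Finset.mem_insert, Finset.mem_singleton, not_or] at hk
      simp [hk.1, hk.2, hg]
  have h := integral_bidLaw_prod_pow hI (Pi.single i s + Pi.single j t : I → ℕ)
  rw [hprod (fun k n => ∫ c, M.β I k c ^ n ∂M.F k) (by simp)] at h
  simp only [Pi.add_apply, Finset.sum_add_distrib, Finset.sum_pi_single', Finset.mem_univ, if_true]
    at h
  rw [← h]
  congr 1
  ext x
  exact (hprod (fun k n => x k ^ n) (by simp)).symm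

theorem uHi_pos (M : ProcurementModel ι uHi) : 0 < uHi :=
  M.uLo_nonneg.trans_lt M.Fu_density.lt

/-- Multiplicative deconvolution: the joint law of two bids determines the law of the heterogeneity
up to scale, and the known upper end of its support determines the scale. -/
theorem Fu_eq (hI : I ∈ M.config.support) (hI' : I ∈ M'.config.support)
    (h : M.bidLaw I = M'.bidLaw I) : M.Fu = M'.Fu := by
  obtain ⟨i, hi, j, hj, hij⟩ := Finset.one_lt_card.1 (M.two_le_card I hI)
  have hmom : ∀ (N : ProcurementModel ι uHi) (n : ℕ), 0 < ∫ u, u ^ n ∂N.Fu := fun N n =>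
    integral_pow_pos_of_ae_mem_Ioc aemeasurable_id N.ae_heterogeneity_mem n
  obtain ⟨κ, hκ, hr⟩ := exists_geometric_ratio
    (m := fun n => ∫ u, u ^ n ∂M.Fu) (m' := fun n => ∫ u, u ^ n ∂M'.Fu)
    (A := fun n => ∫ c, M.β I i c ^ n ∂M.F i) (A' := fun n => ∫ c, M'.β I i c ^ n ∂M'.F i)
    (B := fun n => ∫ c, M.β I j c ^ n ∂M.F j) (B' := fun n => ∫ c, M'.β I j c ^ n ∂M'.F j)
    (hmom M) (hmom M')
    (integral_pow_pos_of_ae_mem_Ioc (aemeasurable_β hI hi) (ae_β_mem hI hi))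
    (integral_pow_pos_of_ae_mem_Ioc (aemeasurable_β hI hj) (ae_β_mem hI hj))
    (by simp) (by simp) (by simp) (by simp) (by simp) (by simp)
    (fun s t => by
      have hne : (⟨i, hi⟩ : I) ≠ ⟨j, hj⟩ := by simpa using hij
      rw [← integral_bidLaw_pow_mul_pow hI hne s t, h, integral_bidLaw_pow_mul_pow hI' hne s t])
  have hscale : M'.Fu = M.Fu.map (fun u => κ * u) := by
    have : IsProbabilityMeasure (M.Fu.map (fun u => κ * u)) :=
      Measure.isProbabilityMeasure_map (by fun_prop)
    refine Measure.ext_of_moments (a := 0) (b := max uHi (κ * uHi)) ?_ ?_ fun n => ?_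
    · filter_upwards [M'.ae_heterogeneity_mem] with u hu
      exact ⟨hu.1.le, hu.2.trans (le_max_left _ _)⟩
    · refine (ae_map_iff (p := (· ∈ Icc _ _)) (by fun_prop) measurableSet_Icc).2 ?_
      filter_upwards [M.ae_heterogeneity_mem] with u hu
      exact ⟨mul_nonneg hκ.le hu.1.le,
        (mul_le_mul_of_nonneg_left hu.2 hκ.le).trans (le_max_right _ _)⟩
    · rw [integral_map (by fun_prop) (by fun_prop)]
      simp only [mul_pow, integral_const_mul]
      exact hr n
  have h1 := M.Fu_density.scale_eq_one M'.Fu_density M.uHi_pos hκ hscale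
  rw [hscale, h1]
  simp

/-- Once the law of the heterogeneity is known, its positive moments can be divided out of those of
the bid of bidder `i`. -/
theorem homogeneousBidLaw_eq (hI : I ∈ M.config.support) (hI' : I ∈ M'.config.support)
    (h : M.bidLaw I = M'.bidLaw I) (hi : i ∈ I) :
    M.homogeneousBidLaw I i = M'.homogeneousBidLaw I i := by
  have hFu := Fu_eq hI hI' h
  obtain ⟨j, hj, hij⟩ := Finset.exists_mem_ne (M.two_le_card I hI) i
  have hprob : ∀ {N : ProcurementModel ι uHi}, I ∈ N.config.support →
      IsProbabilityMeasure (N.homogeneousBidLaw I i) := fun hN =>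
    Measure.isProbabilityMeasure_map (aemeasurable_β hN hi)
  have := hprob hI
  have := hprob hI'
  -- The upper ends of the cost supports are not yet known to agree.
  have hmem : ∀ {N : ProcurementModel ι uHi}, I ∈ N.config.support →
      ∀ᵐ b ∂N.homogeneousBidLaw I i, b ∈ Icc 0 N.hi := fun hN => by
    refine (ae_map_iff (p := (· ∈ Icc _ _)) (aemeasurable_β hN hi) measurableSet_Icc).2 ?_
    exact (ae_β_mem hN hi).mono fun c hc => ⟨hc.1.le, hc.2⟩
  refine Measure.ext_of_moments (a := 0) (b := max M.hi M'.hi)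
    ((hmem hI).mono fun x hx => ⟨hx.1, hx.2.trans (le_max_left _ _)⟩)
    ((hmem hI').mono fun x hx => ⟨hx.1, hx.2.trans (le_max_right _ _)⟩) fun n => ?_
  have hne : (⟨i, hi⟩ : I) ≠ ⟨j, hj⟩ := by simpa using hij.symm
  have h1 := integral_bidLaw_pow_mul_pow hI hne n 0
  rw [h, integral_bidLaw_pow_mul_pow hI' hne n 0, hFu] at h1
  have hpos : 0 < ∫ u, u ^ (n + 0) ∂M'.Fu :=
    integral_pow_pos_of_ae_mem_Ioc aemeasurable_id M'.ae_heterogeneity_mem _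
  rw [homogeneousBidLaw, homogeneousBidLaw,
    integral_map (aemeasurable_β hI hi) (by fun_prop),
    integral_map (aemeasurable_β hI' hi) (by fun_prop)]
  simpa [hpos.ne'] using (mul_left_cancel₀ hpos.ne' h1).symm

end ProcurementModel

/-! ### Revealed preference and equilibrium strategies -/

theorem Real.log_sub_log_le {x y : ℝ} (hx : 0 < x) (hy : 0 < y) :
    Real.log x - Real.log y ≤ (x - y) / y := by
  rw [← Real.log_div hx.ne' hy.ne', sub_div, div_self hy.ne']
  exact Real.log_le_sub_one_of_pos (div_pos hx hy)

/-- Revealed preference for two bidders who face the same log winning probability `w` and maximize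
`θ log (b - c) + w b`: the bid `b₀` is optimal at the cost `c₀` for the weight `θ`, and `b₁` is
optimal at `c₁` for `θ'`. The difference `w b₁ - w b₀` cancels from the two optimality conditions.
As `b₁ → b₀` this becomes one half of the first-order condition, without derivatives of `w`. -/
theorem div_sub_le_div_sub_of_revealed {w : ℝ → ℝ} {θ θ' b₀ b₁ c₀ c₁ : ℝ} (hθ : 0 ≤ θ)
    (hθ' : 0 ≤ θ') (hb : b₀ < b₁) (h₀ : c₀ < b₀) (h₁ : c₁ < b₀)
    (hopt₀ : w b₁ - w b₀ ≤ θ * (Real.log (b₀ - c₀) - Real.log (b₁ - c₀)))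
    (hopt₁ : w b₀ - w b₁ ≤ θ' * (Real.log (b₁ - c₁) - Real.log (b₀ - c₁))) :
    θ / (b₁ - c₀) ≤ θ' / (b₀ - c₁) := by
  have e₀ := mul_le_mul_of_nonneg_left
    (Real.log_sub_log_le (x := b₀ - c₀) (y := b₁ - c₀) (by linarith) (by linarith)) hθ
  have e₁ := mul_le_mul_of_nonneg_left
    (Real.log_sub_log_le (x := b₁ - c₁) (y := b₀ - c₁) (by linarith) (by linarith)) hθ'
  have key : (b₁ - b₀) * (θ / (b₁ - c₀)) ≤ (b₁ - b₀) * (θ' / (b₀ - c₁)) := by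
    have r₀ : θ * ((b₀ - c₀ - (b₁ - c₀)) / (b₁ - c₀)) = -((b₁ - b₀) * (θ / (b₁ - c₀))) := by ring
    have r₁ : θ' * ((b₁ - c₁ - (b₀ - c₁)) / (b₀ - c₁)) = (b₁ - b₀) * (θ' / (b₀ - c₁)) := by ring
    linarith
  exact le_of_mul_le_mul_left key (by linarith)

/-- If the same continuous strategy `β` is optimal against the log winning probabilities `w₁` and
`w₂`, then `w₁ - w₂` is constant along `β`. The derivative of the value
`θ log (β c - c) + w (β c)` with respect to the cost is `-θ / (β c - c)` by the envelope theorem,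
whatever `w` is, so the two values differ by a constant. -/
theorem sub_eq_sub_of_common_optimum {w₁ w₂ β : ℝ → ℝ} {θ lo hi : ℝ} (hθ : 0 ≤ θ)
    (hβ : ContinuousOn β (Ioo lo hi)) (hlt : ∀ c ∈ Ioo lo hi, c < β c)
    (h₁ : ∀ c ∈ Ioo lo hi, ∀ d ∈ Ioo lo hi, c < β d →
      w₁ (β d) - w₁ (β c) ≤ θ * (Real.log (β c - c) - Real.log (β d - c)))
    (h₂ : ∀ c ∈ Ioo lo hi, ∀ d ∈ Ioo lo hi, c < β d →
      w₂ (β d) - w₂ (β c) ≤ θ * (Real.log (β c - c) - Real.log (β d - c)))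
    {c d : ℝ} (hc : c ∈ Ioo lo hi) (hd : d ∈ Ioo lo hi) :
    w₁ (β c) - w₂ (β c) = w₁ (β d) - w₂ (β d) := by
  set D : ℝ → ℝ := fun x => w₁ (β x) - w₂ (β x) with hD
  -- Optimality at `x` and at `y` encloses the increment of either value function between the same
  -- two bounds, whose distance is of smaller order than `y - x`.
  have hbound : ∀ x ∈ Ioo lo hi, ∀ y ∈ Ioo lo hi, x < β y → y < β x →
      |D y - D x| ≤ θ * ((y - x) * (1 / (β x - y) - 1 / (β y - x))) := by
    intro x hx y hy hxy hyx
    have a₁ := h₁ x hx y hy hxy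
    have a₂ := h₂ x hx y hy hxy
    have b₁ := h₁ y hy x hx hyx
    have b₂ := h₂ y hy x hx hyx
    have hx' := hlt x hx
    have hy' := hlt y hy
    have l₁ := mul_le_mul_of_nonneg_left
      (Real.log_sub_log_le (x := β y - y) (y := β y - x) (by linarith) (by linarith)) hθ
    have l₂ := mul_le_mul_of_nonneg_left
      (Real.log_sub_log_le (x := β x - x) (y := β x - y) (by linarith) (by linarith)) hθ
    have e : θ * ((y - x) * (1 / (β x - y) - 1 / (β y - x)))
        = θ * ((β y - y - (β y - x)) / (β y - x)) + θ * ((β x - x - (β x - y)) / (β x - y)) := by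
      ring
    rw [e, abs_le]
    simp only [hD]
    constructor <;> linarith
  have hderiv : ∀ x ∈ Ioo lo hi, HasDerivAt D 0 x := by
    intro x hx
    have hβx : ContinuousAt β x := hβ.continuousAt (isOpen_Ioo.mem_nhds hx)
    have hx' := hlt x hx
    have t : Tendsto (fun y => θ * (1 / (β x - y) - 1 / (β y - x))) (𝓝 x) (𝓝 0) := by
      have t₁ : Tendsto (fun y => 1 / (β x - y)) (𝓝 x) (𝓝 (1 / (β x - x))) :=
        (tendsto_const_nhds.div (tendsto_const_nhds.sub tendsto_id) (by linarith))
      have t₂ : Tendsto (fun y => 1 / (β y - x)) (𝓝 x) (𝓝 (1 / (β x - x))) :=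
        (tendsto_const_nhds.div (hβx.tendsto.sub tendsto_const_nhds) (by linarith))
      simpa using (t₁.sub t₂).const_mul θ
    rw [hasDerivAt_iff_isLittleO]
    refine Asymptotics.isLittleO_iff.2 fun ε hε => ?_
    filter_upwards [isOpen_Ioo.mem_nhds hx, hβx.eventually (lt_mem_nhds hx'),
      eventually_lt_nhds hx', t.eventually (Metric.ball_mem_nhds 0 hε)] with y hy hxy hyx hty
    have hb := hbound x hx y hy hxy hyx
    simp only [smul_zero, sub_zero, Real.norm_eq_abs]
    rw [dist_zero_right, Real.norm_eq_abs] at hty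
    calc |D y - D x| ≤ _ := hb
      _ = θ * (1 / (β x - y) - 1 / (β y - x)) * (y - x) := by ring
      _ ≤ |θ * (1 / (β x - y) - 1 / (β y - x)) * (y - x)| := le_abs_self _
      _ = |θ * (1 / (β x - y) - 1 / (β y - x))| * |y - x| := abs_mul _ _
      _ ≤ ε * |y - x| := by
        gcongr
  refine isOpen_Ioo.is_const_of_deriv_eq_zero isPreconnected_Ioo
    (fun x hx => (hderiv x hx).differentiableAt.differentiableWithinAt)
    (fun x hx => (hderiv x hx).deriv) hc hd

namespace IsEquilibrium

variable {ι : Type*} [DecidableEq ι] {F F' : ι → Measure ℝ} {η η' : ι → ℝ} {lo lo' hi : ℝ}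
  {I J : Finset ι} {β β' : ι → ℝ → ℝ} {i j : ι}

theorem β_lt_hi (hE : IsEquilibrium F η lo hi I β) (hi' : i ∈ I) {c : ℝ} (hc : c ∈ Ico lo hi) :
    β i c < hi := by
  have := hE.strictMono i hi' ⟨hc.1, hc.2.le⟩ ⟨hc.1.trans hc.2.le, le_rfl⟩ hc.2
  rwa [hE.top i hi'] at this

theorem exists_β_eq (hE : IsEquilibrium F η lo hi I β) (hi' : i ∈ I) {x b : ℝ} (hx : x ∈ Icc lo hi)
    (hxb : β i x ≤ b) (hb : b ≤ hi) : ∃ y ∈ Icc x hi, β i y = b :=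
  intermediate_value_Icc hx.2 ((hE.continuous i hi').mono (Icc_subset_Icc_left hx.1))
    ⟨hxb, by rwa [hE.top i hi']⟩

/-- Bids fill the interval from `β i lo` to `hi` without gaps. -/
theorem real_lt_of_lt (hE : IsEquilibrium F η lo hi I β) (hF : HasPositiveDensityOn (F i) lo hi)
    (hi' : i ∈ I) {b₁ b₂ : ℝ} (h₁ : β i lo ≤ b₁) (h : b₁ < b₂) (h₂ : b₂ ≤ hi) :
    (F i).real {c | b₂ < β i c} < (F i).real {c | b₁ < β i c} := by
  have := hF.isProbabilityMeasure
  obtain ⟨x, hx, rfl⟩ := hE.exists_β_eq hi' (left_mem_Icc.2 hF.lt.le) h₁ (h.le.trans h₂)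
  obtain ⟨y, hy, rfl⟩ := hE.exists_β_eq hi' hx h.le h₂
  have hxy : x < y := lt_of_le_of_ne hy.1 (by rintro rfl; exact lt_irrefl _ h)
  have hymem : y ∈ Icc lo hi := ⟨hx.1.trans hy.1, hy.2⟩
  have hm : ∀ c ∈ Ioo x y, c ∈ Icc lo hi := fun c hc => ⟨hx.1.trans hc.1.le, hc.2.le.trans hy.2⟩
  have hdisj : Disjoint {c | β i y < β i c} (Ioo x y) := by
    refine Set.disjoint_left.2 fun c hc hc' => ?_
    exact lt_asymm (show β i y < β i c from hc) (hE.strictMono i hi' (hm c hc') hymem hc'.2)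
  calc (F i).real {c | β i y < β i c}
      < (F i).real {c | β i y < β i c} + (F i).real (Ioo x y) :=
        lt_add_of_pos_right _ (hF.real_pos_of_Ioo_subset hx.1 hxy hy.2 subset_rfl)
    _ = (F i).real ({c | β i y < β i c} ∪ Ioo x y) :=
        (measureReal_union hdisj measurableSet_Ioo).symm
    _ ≤ _ := by
        refine measureReal_mono (union_subset (fun c hc => ?_) fun c hc => ?_)
        · exact h.trans (show β i y < β i c from hc)
        · exact hE.strictMono i hi' hx (hm c hc) hc.1

theorem real_pos (hE : IsEquilibrium F η lo hi I β) (hF : HasPositiveDensityOn (F i) lo hi)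
    (hi' : i ∈ I) {b : ℝ} (hb : b < hi) : 0 < (F i).real {c | b < β i c} := by
  have := hF.isProbabilityMeasure
  have hlo : β i lo < hi := hE.β_lt_hi hi' (left_mem_Ico.2 hF.lt)
  calc 0 ≤ (F i).real {c | hi < β i c} := measureReal_nonneg
    _ < (F i).real {c | max b (β i lo) < β i c} :=
      hE.real_lt_of_lt hF hi' (le_max_right _ _) (max_lt hb hlo) le_rfl
    _ ≤ _ := measureReal_mono fun c hc =>
      (le_max_left _ _).trans_lt (show max b (β i lo) < β i c from hc)

theorem winProb_pos (hE : IsEquilibrium F η lo hi I β) (hF : ∀ i, HasPositiveDensityOn (F i) lo hi)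
    {b : ℝ} (hb : b < hi) : 0 < winProb F I β i b :=
  Finset.prod_pos fun j hj => hE.real_pos (hF j) (Finset.mem_of_mem_erase hj) hb

/-- Bidding the own cost yields `0 ^ (1 - η) = 0`, while any bid between the cost and `hi` has a
positive payoff. -/
theorem cost_lt (hE : IsEquilibrium F η lo hi I β) (hF : ∀ i, HasPositiveDensityOn (F i) lo hi)
    (hη : η i < 1) (hi' : i ∈ I) {c : ℝ} (hc : c ∈ Ico lo hi) : c < β i c := by
  refine lt_of_le_of_ne (hE.cost_le i hi' c ⟨hc.1, hc.2.le⟩) fun h => ?_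
  have h1 := hE.best i hi' c ⟨hc.1, hc.2.le⟩ ((c + hi) / 2) (by linarith [hc.2])
  rw [← h] at h1
  have h2 : expectedUtility F η I β i c c = 0 := by
    simp [expectedUtility, crra, Real.zero_rpow (sub_pos.2 hη).ne']
  rw [h2] at h1
  refine h1.not_gt (mul_pos (Real.rpow_pos_of_pos ?_ _) (hE.winProb_pos hF ?_)) <;>
    linarith [hc.2]

/-- The equilibrium condition in logarithms. -/
theorem log_winProb_sub_le (hE : IsEquilibrium F η lo hi I β)
    (hF : ∀ i, HasPositiveDensityOn (F i) lo hi) (hη : η i < 1) (hi' : i ∈ I) {c x : ℝ}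
    (hc : c ∈ Ico lo hi) (hcx : c < x) (hx : x < hi) :
    Real.log (winProb F I β i x) - Real.log (winProb F I β i (β i c))
      ≤ (1 - η i) * (Real.log (β i c - c) - Real.log (x - c)) := by
  have h := hE.best i hi' c ⟨hc.1, hc.2.le⟩ x hcx.le
  have p1 : 0 < (x - c) ^ (1 - η i) := Real.rpow_pos_of_pos (by linarith) _
  have hlt := hE.cost_lt hF hη hi' hc
  have p2 : 0 < (β i c - c) ^ (1 - η i) := Real.rpow_pos_of_pos (by linarith) _
  have w1 := hE.winProb_pos (i := i) hF hx
  have w2 := hE.winProb_pos (i := i) hF (hE.β_lt_hi hi' hc)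
  unfold expectedUtility crra at h
  have h' := Real.log_le_log (mul_pos p1 w1) h
  rw [Real.log_mul p1.ne' w1.ne', Real.log_mul p2.ne' w2.ne', Real.log_rpow (by linarith),
    Real.log_rpow (by linarith)] at h'
  linarith

theorem div_markup_le (hE : IsEquilibrium F η lo hi I β)
    (hE' : IsEquilibrium F' η' lo' hi I β') (hF : ∀ i, HasPositiveDensityOn (F i) lo hi)
    (hF' : ∀ i, HasPositiveDensityOn (F' i) lo' hi) (hη : η i < 1) (hη' : η' i < 1) (hi' : i ∈ I)
    (hW : winProb F I β i = winProb F' I β' i) {c c' : ℝ} (hc : c ∈ Ico lo hi)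
    (hc' : c' ∈ Ico lo' hi) (h : β i c = β' i c') :
    (1 - η i) / (β i c - c) ≤ (1 - η' i) / (β' i c' - c') := by
  have hlt := hE.cost_lt hF hη hi' hc
  have hlt' := hE'.cost_lt hF' hη' hi' hc'
  -- Compare the optimal bid at `c` with those in the other equilibrium at costs `x` decreasing to `c'`.
  -- Limits from the right also cover the lowest cost.
  have hcont : Tendsto (β' i) (𝓝[>] c') (𝓝 (β' i c')) :=
    ((hE'.continuous i hi') c' ⟨hc'.1, hc'.2.le⟩).tendsto.mono_left
      (nhdsWithin_le_of_mem (mem_of_superset (Ioo_mem_nhdsGT hc'.2)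
        fun x hx => ⟨hc'.1.trans hx.1.le, hx.2.le⟩))
  have hid : Tendsto (fun x : ℝ => x) (𝓝[>] c') (𝓝 c') := tendsto_id.mono_left nhdsWithin_le_nhds
  have t₁ : Tendsto (fun x => (1 - η i) / (β' i x - c)) (𝓝[>] c') (𝓝 ((1 - η i) / (β i c - c))) := by
    rw [h]
    exact tendsto_const_nhds.div (hcont.sub tendsto_const_nhds) (by linarith)
  have t₂ : Tendsto (fun x => (1 - η' i) / (β' i c' - x)) (𝓝[>] c')
      (𝓝 ((1 - η' i) / (β' i c' - c'))) :=
    tendsto_const_nhds.div (tendsto_const_nhds.sub hid) (by linarith)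
  refine le_of_tendsto_of_tendsto t₁ t₂ ?_
  filter_upwards [Ioo_mem_nhdsGT hc'.2, hid.eventually (gt_mem_nhds hlt')] with x hx hxb
  have hx' : x ∈ Ico lo' hi := ⟨hc'.1.trans hx.1.le, hx.2⟩
  have hb : β' i c' < β' i x :=
    hE'.strictMono i hi' ⟨hc'.1, hc'.2.le⟩ ⟨hx'.1, hx'.2.le⟩ hx.1
  refine div_sub_le_div_sub_of_revealed (w := fun b => Real.log (winProb F I β i b))
    (by linarith) (by linarith) hb (by linarith) hxb ?_ ?_
  · have := hE.log_winProb_sub_le hF hη hi' hc (x := β' i x) (by linarith) (hE'.β_lt_hi hi' hx')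
    rwa [h] at this
  · have := hE'.log_winProb_sub_le hF' hη' hi' hx' hxb (hE'.β_lt_hi hi' hc')
    rwa [hW]

/-- The first-order condition, in a form that compares two equilibria: a bid that occurs in both,
at costs `c` and `c'`, against the same winning probability has the same ratio of `1 - η` to
the markup, as both equal minus the logarithmic derivative of the winning probability. -/
theorem div_markup_eq (hE : IsEquilibrium F η lo hi I β)
    (hE' : IsEquilibrium F' η' lo' hi I β') (hF : ∀ i, HasPositiveDensityOn (F i) lo hi)
    (hF' : ∀ i, HasPositiveDensityOn (F' i) lo' hi) (hη : η i < 1) (hη' : η' i < 1) (hi' : i ∈ I)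
    (hW : winProb F I β i = winProb F' I β' i) {c c' : ℝ} (hc : c ∈ Ico lo hi)
    (hc' : c' ∈ Ico lo' hi) (h : β i c = β' i c') :
    (1 - η i) / (β i c - c) = (1 - η' i) / (β' i c' - c') :=
  le_antisymm (hE.div_markup_le hE' hF hF' hη hη' hi' hW hc hc' h)
    (hE'.div_markup_le hE hF' hF hη' hη hi' hW.symm hc' hc h.symm)

/-- Additional bidders change the strategy of some incumbent. Otherwise every incumbent would have
the same optimal bids against two winning probabilities whose ratio, the probability that all
entrants bid higher, is not constant. -/
theorem exists_ne_of_ssubset (hE : IsEquilibrium F η lo hi I β) (hE' : IsEquilibrium F η lo hi J β')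
    (hF : ∀ i, HasPositiveDensityOn (F i) lo hi) (hη : ∀ i, η i < 1) (hIJ : I ⊂ J)
    (hI : I.Nonempty) : ∃ i ∈ I, ∃ c ∈ Ico lo hi, β i c ≠ β' i c := by
  by_contra! hcon
  obtain ⟨i, hi'⟩ := hI
  obtain ⟨k, hkJ, hkI⟩ := Finset.exists_of_ssubset hIJ
  have hlh := (hF i).lt
  have hmem : ∀ {c}, c ∈ Ioo lo hi → c ∈ Ico lo hi := fun hc => ⟨hc.1.le, hc.2⟩
  -- The larger bidder set multiplies the winning probability by the factor `V`.
  set V : ℝ → ℝ := fun b => ∏ j ∈ J \ I, (F j).real {c | b < β' j c} with hV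
  have hW : ∀ b, winProb F J β' i b = winProb F I β i b * V b := by
    intro b
    have hsplit : J.erase i = I.erase i ∪ J \ I := by
      ext x
      have := @hIJ.1 x
      simp only [Finset.mem_erase, Finset.mem_union, Finset.mem_sdiff]
      grind
    have hdisj : Disjoint (I.erase i) (J \ I) :=
      Finset.disjoint_left.2 fun x hx hx' => (Finset.mem_sdiff.1 hx').2 (Finset.mem_of_mem_erase hx)
    rw [winProb, hsplit, Finset.prod_union hdisj, winProb]
    congr 1
    refine Finset.prod_congr rfl fun j hj => measureReal_congr ?_
    have hne : ∀ᵐ c ∂F j, c ≠ hi := (hF j).absolutelyContinuous (by simp)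
    filter_upwards [(hF j).ae_mem_Icc, hne] with c hc hc'
    exact propext (by
      change b < β' j c ↔ b < β j c
      rw [hcon j (Finset.mem_of_mem_erase hj) c ⟨hc.1, lt_of_le_of_ne hc.2 hc'⟩])
  have hVanti : ∀ {b₁ b₂ : ℝ}, β' k lo ≤ b₁ → b₁ < b₂ → b₂ < hi → V b₂ < V b₁ := by
    intro b₁ b₂ h₁ h h₂
    refine Finset.prod_lt_prod
      (fun j hj => hE'.real_pos (hF j) (Finset.mem_sdiff.1 hj).1 h₂) (fun j _ => ?_)
      ⟨k, Finset.mem_sdiff.2 ⟨hkJ, hkI⟩, hE'.real_lt_of_lt (hF k) hkJ h₁ h h₂.le⟩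
    have := (hF j).isProbabilityMeasure
    exact measureReal_mono fun c hc => h.trans (show b₂ < β' j c from hc)
  have hβi : ∀ c ∈ Ioo lo hi, β' i c = β i c := fun c hc => (hcon i hi' c (hmem hc)).symm
  have hconst := fun {c d : ℝ} => sub_eq_sub_of_common_optimum
    (w₁ := fun b => Real.log (winProb F I β i b)) (w₂ := fun b => Real.log (winProb F J β' i b))
    (β := β i) (lo := lo) (hi := hi) (θ := 1 - η i) (by linarith [hη i])
    ((hE.continuous i hi').mono Ioo_subset_Icc_self)
    (fun c hc => hE.cost_lt hF (hη i) hi' (hmem hc))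
    (fun c hc d hd hcd => hE.log_winProb_sub_le hF (hη i) hi' (hmem hc) hcd
      (hE.β_lt_hi hi' (hmem hd)))
    (fun c hc d hd hcd => by
      have := hE'.log_winProb_sub_le hF (hη i) (hIJ.1 hi') (hmem hc) hcd
        (hE.β_lt_hi hi' (hmem hd))
      rwa [hβi c hc] at this) (c := c) (d := d)
  -- Near the top, the bids of the incumbent lie in the range of those of the entrant `k`.
  obtain ⟨x, hx, hxk⟩ : ∃ x ∈ Ico lo hi, β' k lo ≤ β i x := by
    have hk := hE'.β_lt_hi hkJ (left_mem_Ico.2 hlh)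
    have hii := hE.β_lt_hi hi' (left_mem_Ico.2 hlh)
    obtain ⟨x, hx, hxe⟩ := hE.exists_β_eq hi' (left_mem_Icc.2 hlh.le)
      (le_max_right (β' k lo) (β i lo)) (max_lt hk hii).le
    refine ⟨x, ⟨hx.1, lt_of_le_of_ne hx.2 ?_⟩, hxe ▸ le_max_left _ _⟩
    rintro rfl
    rw [hE.top i hi'] at hxe
    exact (max_lt hk hii).ne hxe.symm
  obtain ⟨c, hxc, hc⟩ := exists_between hx.2
  obtain ⟨d, hcd, hd⟩ := exists_between hc
  have hcm : c ∈ Ioo lo hi := ⟨hx.1.trans_lt hxc, hc⟩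
  have hdm : d ∈ Ioo lo hi := ⟨hcm.1.trans hcd, hd⟩
  have hbc := hE.β_lt_hi hi' (hmem hcm)
  have hbd := hE.β_lt_hi hi' (hmem hdm)
  have h := hconst hcm hdm
  have hVpos : ∀ {b : ℝ}, b < hi → 0 < V b := fun hb =>
    Finset.prod_pos fun j hj => hE'.real_pos (hF j) (Finset.mem_sdiff.1 hj).1 hb
  simp only [hW] at h
  rw [Real.log_mul (hE.winProb_pos hF hbc).ne' (hVpos hbc).ne',
    Real.log_mul (hE.winProb_pos hF hbd).ne' (hVpos hbd).ne'] at h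
  have hlt := Real.log_lt_log (hVpos hbd) (hVanti
    (hxk.trans (hE.strictMono i hi' ⟨hx.1, hx.2.le⟩ ⟨hcm.1.le, hc.le⟩ hxc).le)
    (hE.strictMono i hi' ⟨hcm.1.le, hc.le⟩ ⟨hdm.1.le, hd.le⟩ hcd) hbd)
  linarith

end IsEquilibrium

/-! ### Recovering costs and risk aversion from the homogeneous bids -/

namespace ProcurementModel

variable {ι : Type*} [DecidableEq ι] {uHi : ℝ} {M M' : ProcurementModel ι uHi} {I J : Finset ι}
  {i : ι}

theorem homogeneousBidLaw_real_Ioi (hI : I ∈ M.config.support) (hi : i ∈ I) (b : ℝ) :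
    (M.homogeneousBidLaw I i).real (Ioi b) = (M.F i).real {c | b < M.β I i c} := by
  rw [Measure.real, Measure.real, homogeneousBidLaw,
    Measure.map_apply_of_aemeasurable (aemeasurable_β hI hi) measurableSet_Ioi]
  rfl

theorem hi_eq (hI : I ∈ M.config.support) (hI' : I ∈ M'.config.support)
    (hi : i ∈ I) (h : M.homogeneousBidLaw I i = M'.homogeneousBidLaw I i) : M.hi = M'.hi := by
  have hle : ∀ {N N' : ProcurementModel ι uHi}, I ∈ N.config.support → I ∈ N'.config.support →
      N.homogeneousBidLaw I i = N'.homogeneousBidLaw I i → N.hi ≤ N'.hi := by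
    intro N N' hN hN' h
    by_contra! hlt
    have h1 := (N.equilibrium I hN).real_pos (N.F_density i) hi hlt
    rw [← homogeneousBidLaw_real_Ioi hN hi, h, homogeneousBidLaw_real_Ioi hN' hi] at h1
    refine h1.ne' ?_
    rw [measureReal_eq_zero_iff, measure_eq_zero_iff_ae_notMem]
    filter_upwards [ae_β_mem hN' hi] with c hc hc'
    exact hc.2.not_gt hc'
  exact le_antisymm (hle hI hI' h) (hle hI' hI h.symm)

theorem winProb_eq (hI : I ∈ M.config.support) (hI' : I ∈ M'.config.support)
    (h : ∀ j ∈ I, M.homogeneousBidLaw I j = M'.homogeneousBidLaw I j) (i : ι) :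
    winProb M.F I (M.β I) i = winProb M'.F I (M'.β I) i := by
  ext b
  refine Finset.prod_congr rfl fun j hj => ?_
  have hj' := Finset.mem_of_mem_erase hj
  rw [← homogeneousBidLaw_real_Ioi hI hj', h j hj', homogeneousBidLaw_real_Ioi hI' hj']

theorem homogeneousBidLaw_Ici_β (hI : I ∈ M.config.support) (hi : i ∈ I) {c : ℝ}
    (hc : c ∈ Icc M.lo M.hi) : M.homogeneousBidLaw I i (Ici (M.β I i c)) = M.F i (Ici c) := by
  rw [homogeneousBidLaw, Measure.map_apply_of_aemeasurable (aemeasurable_β hI hi) measurableSet_Ici]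
  refine measure_congr ?_
  filter_upwards [(M.F_density i).ae_mem_Icc] with x hx
  exact propext (((M.equilibrium I hI).strictMono i hi).le_iff_le hc hx)

theorem homogeneousBidLaw_Ici_lt (hI : I ∈ M.config.support) (hi : i ∈ I) {c b : ℝ}
    (hc : c ∈ Ico M.lo M.hi) (hb : M.β I i c < b) (hb' : b ≤ M.hi) :
    M.homogeneousBidLaw I i (Ici b) < M.homogeneousBidLaw I i (Ici (M.β I i c)) := by
  have hcm : c ∈ Icc M.lo M.hi := ⟨hc.1, hc.2.le⟩
  obtain ⟨y, hy, rfl⟩ := (M.equilibrium I hI).exists_β_eq hi hcm hb.le hb'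
  have hcy : c < y := lt_of_le_of_ne hy.1 (by rintro rfl; exact lt_irrefl _ hb)
  rw [homogeneousBidLaw_Ici_β hI hi hcm, homogeneousBidLaw_Ici_β hI hi ⟨hc.1.trans hy.1, hy.2⟩]
  have hdisj : Disjoint (Ici y) (Ioo c y) :=
    Set.disjoint_left.2 fun x hx hx' => (mem_Ici.1 hx).not_gt hx'.2
  calc M.F i (Ici y) < M.F i (Ici y) + M.F i (Ioo c y) :=
        ENNReal.lt_add_right (measure_ne_top _ _)
          ((M.F_density i).pos_of_Ioo_subset hc.1 hcy hy.2 subset_rfl).ne'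
    _ = M.F i (Ici y ∪ Ioo c y) := (measure_union hdisj measurableSet_Ioo).symm
    _ ≤ M.F i (Ici c) := measure_mono (union_subset (Ici_subset_Ici.2 hcy.le) fun x hx => hx.1.le)

/-- Costs at the same quantile lead to the same homogeneous bid in two models with the same bid
law. -/
theorem β_eq_iff (hI : I ∈ M.config.support) (hI' : I ∈ M'.config.support) (hi : i ∈ I)
    (h : M.homogeneousBidLaw I i = M'.homogeneousBidLaw I i) {c c' : ℝ} (hc : c ∈ Ico M.lo M.hi)
    (hc' : c' ∈ Ico M'.lo M'.hi) : M.β I i c = M'.β I i c' ↔ M.F i (Ici c) = M'.F i (Ici c') := by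
  have hhi := hi_eq hI hI' hi h
  have e := homogeneousBidLaw_Ici_β hI hi (Ico_subset_Icc_self hc)
  have e' := homogeneousBidLaw_Ici_β hI' hi (Ico_subset_Icc_self hc')
  have b := (M.equilibrium I hI).β_lt_hi hi hc
  have b' := (M'.equilibrium I hI').β_lt_hi hi hc'
  refine ⟨fun hβ => by rw [← e, ← e', h, hβ], fun hF => ?_⟩
  rcases lt_trichotomy (M.β I i c) (M'.β I i c') with hlt | heq | hgt
  · have := homogeneousBidLaw_Ici_lt hI hi hc hlt (hhi ▸ b'.le)
    rw [e, h, e', hF] at this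
    exact absurd this (lt_irrefl _)
  · exact heq
  · have := homogeneousBidLaw_Ici_lt hI' hi hc' hgt (hhi ▸ b.le)
    rw [e', ← h, e, hF] at this
    exact absurd this (lt_irrefl _)

theorem F_Ici_lo (M : ProcurementModel ι uHi) (i : ι) : M.F i (Ici M.lo) = 1 :=
  (mem_ae_iff_prob_eq_one measurableSet_Ici).1 ((M.F_density i).ae_mem_Icc.mono fun _ hx => hx.1)

theorem lo_mem (M : ProcurementModel ι uHi) (i : ι) : M.lo ∈ Ico M.lo M.hi :=
  left_mem_Ico.2 (M.lo_lt_hi i)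

/-- Every bid in `M` is also a bid in `M'`, at a cost that by `β_eq_iff` is the same for every bidder
set. -/
theorem exists_β_eq (hI : I ∈ M.config.support) (hI' : I ∈ M'.config.support) (hi : i ∈ I)
    (h : M.homogeneousBidLaw I i = M'.homogeneousBidLaw I i) {c : ℝ} (hc : c ∈ Ico M.lo M.hi) :
    ∃ c' ∈ Ico M'.lo M'.hi, M.β I i c = M'.β I i c' := by
  have hlo : M.β I i M.lo = M'.β I i M'.lo :=
    (β_eq_iff hI hI' hi h (M.lo_mem i) (M'.lo_mem i)).2 (by rw [F_Ici_lo, F_Ici_lo])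
  have hE := M.equilibrium I hI
  have hE' := M'.equilibrium I hI'
  have hhi := hi_eq hI hI' hi h
  have hlt := hE.β_lt_hi hi hc
  obtain ⟨c', hc', hβ⟩ := hE'.exists_β_eq hi (left_mem_Icc.2 (M'.lo_lt_hi i).le)
    (hlo ▸ (hE.strictMono i hi).monotoneOn (Ico_subset_Icc_self (M.lo_mem i))
      (Ico_subset_Icc_self hc) hc.1) (hhi ▸ hlt.le)
  refine ⟨c', ⟨hc'.1, lt_of_le_of_ne hc'.2 ?_⟩, hβ.symm⟩
  rintro rfl
  rw [hE'.top i hi, ← hhi] at hβ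
  exact hlt.ne hβ.symm

/-- The first-order conditions of two models with the same bid laws: the markups on the same bid
are in the proportion `1 - M.η i : 1 - M'.η i`, which does not depend on the bidder set. -/
theorem markup_eq (hI : I ∈ M.config.support) (hI' : I ∈ M'.config.support)
    (h : ∀ j ∈ I, M.homogeneousBidLaw I j = M'.homogeneousBidLaw I j) (hi : i ∈ I)
    {c c' : ℝ} (hc : c ∈ Ico M.lo M.hi) (hc' : c' ∈ Ico M'.lo M'.hi)
    (hβ : M.β I i c = M'.β I i c') :
    (1 - M.η i) * (M.β I i c - c') = (1 - M'.η i) * (M.β I i c - c) := by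
  have hhi := hi_eq hI hI' hi (h i hi)
  have hE' : IsEquilibrium M'.F M'.η M'.lo M.hi I (M'.β I) := hhi ▸ M'.equilibrium I hI'
  have hF' : ∀ i, HasPositiveDensityOn (M'.F i) M'.lo M.hi := fun i => hhi ▸ M'.F_density i
  have hE := M.equilibrium I hI
  have h1 := hE.div_markup_eq hE' M.F_density hF' (M.η_mem i).2
    (M'.η_mem i).2 hi (winProb_eq hI hI' h i) hc (hhi ▸ hc') hβ
  have p := hE.cost_lt M.F_density (M.η_mem i).2 hi hc
  have p' := hE'.cost_lt hF' (M'.η_mem i).2 hi (hhi ▸ hc')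
  rw [← hβ] at h1 p'
  rwa [div_eq_div_iff (sub_pos.2 p).ne' (sub_pos.2 p').ne'] at h1

/-- With the utility function known, the markups and hence the costs can be read off the bids. -/
theorem F_eq_of_η_eq (hI : I ∈ M.config.support) (hI' : I ∈ M'.config.support)
    (h : ∀ j ∈ I, M.homogeneousBidLaw I j = M'.homogeneousBidLaw I j) (hi : i ∈ I)
    (hη : M.η i = M'.η i) : M.F i = M'.F i := by
  have key : ∀ c ∈ Ico M.lo M.hi, c ∈ Ico M'.lo M'.hi ∧ M.F i (Ici c) = M'.F i (Ici c) := by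
    intro c hc
    obtain ⟨c', hc', hβ⟩ := exists_β_eq hI hI' hi (h i hi) hc
    have h1 := markup_eq hI hI' h hi hc hc' hβ
    rw [hη] at h1
    have h2 := mul_left_cancel₀ (sub_pos.2 (M'.η_mem i).2).ne' h1
    obtain rfl : c' = c := by linarith
    exact ⟨hc', (β_eq_iff hI hI' hi (h i hi) hc hc').1 hβ⟩
  have hhi := hi_eq hI hI' hi (h i hi)
  obtain ⟨hm, h1⟩ := key _ (M.lo_mem i)
  rw [F_Ici_lo] at h1
  have hbelow : ∀ {N : ProcurementModel ι uHi} {c : ℝ}, N.F i (Ici M.lo) = 1 → c ≤ M.lo →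
      N.F i (Ici c) = 1 := fun hN hc =>
    le_antisymm prob_le_one (hN ▸ measure_mono (Ici_subset_Ici.2 hc))
  have habove : ∀ {N : ProcurementModel ι uHi} {c : ℝ}, N.hi ≤ c → N.F i (Ici c) = 0 := by
    intro N c hc
    rw [measure_eq_zero_iff_ae_notMem]
    have hne : ∀ᵐ x ∂N.F i, x ≠ N.hi := (N.F_density i).absolutelyContinuous (by simp)
    filter_upwards [(N.F_density i).ae_mem_Icc, hne] with x hx hx' hcx
    exact hx' (le_antisymm hx.2 (hc.trans hcx))
  refine Measure.ext_of_Ici _ _ fun c => ?_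
  rcases lt_or_ge c M.lo with hc | hc
  · rw [hbelow (M.F_Ici_lo i) hc.le, hbelow h1.symm hc.le]
  rcases lt_or_ge c M.hi with hc' | hc'
  · exact (key c ⟨hc, hc'⟩).2
  · rw [habove hc', habove (hhi ▸ hc')]

/-- The lowest bid of bidder `i` is placed at the lowest cost. If that cost is known, so is the
markup, which is positive and determines the risk aversion. -/
theorem η_eq_of_lo_eq (hI : I ∈ M.config.support) (hI' : I ∈ M'.config.support)
    (h : ∀ j ∈ I, M.homogeneousBidLaw I j = M'.homogeneousBidLaw I j) (hi : i ∈ I)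
    (hlo : M.lo = M'.lo) : M.η i = M'.η i := by
  have hβ : M.β I i M.lo = M'.β I i M'.lo :=
    (β_eq_iff hI hI' hi (h i hi) (M.lo_mem i) (M'.lo_mem i)).2 (by rw [F_Ici_lo, F_Ici_lo])
  have h1 := markup_eq hI hI' h hi (M.lo_mem i) (M'.lo_mem i) hβ
  rw [← hlo] at h1
  have p := (M.equilibrium I hI).cost_lt M.F_density (M.η_mem i).2 hi (M.lo_mem i)
  linarith [mul_right_cancel₀ (sub_pos.2 p).ne' h1]

/-- A bidder who bids differently in two bidder sets at the same cost `c` reveals her risk aversion: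
the cost `c'` of the other model at the same quantile is common to both bidder sets, so the
difference of the two bids equals `(1 - M'.η i) / (1 - M.η i)` times itself. -/
theorem η_eq_of_β_ne (hI : I ∈ M.config.support) (hI' : I ∈ M'.config.support)
    (hJ : J ∈ M.config.support) (hJ' : J ∈ M'.config.support)
    (h : ∀ j ∈ I, M.homogeneousBidLaw I j = M'.homogeneousBidLaw I j)
    (h' : ∀ j ∈ J, M.homogeneousBidLaw J j = M'.homogeneousBidLaw J j)
    (hiI : i ∈ I) (hiJ : i ∈ J) {c : ℝ} (hc : c ∈ Ico M.lo M.hi) (hne : M.β I i c ≠ M.β J i c) :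
    M.η i = M'.η i := by
  obtain ⟨c', hc', hβ⟩ := exists_β_eq hI hI' hiI (h i hiI) hc
  have hβ' : M.β J i c = M'.β J i c' := (β_eq_iff hJ hJ' hiJ (h' i hiJ) hc hc').2
    ((β_eq_iff hI hI' hiI (h i hiI) hc hc').1 hβ)
  have h1 := markup_eq hI hI' h hiI hc hc' hβ
  have h2 := markup_eq hJ hJ' h' hiJ hc hc' hβ'
  have h3 : (1 - M.η i) * (M.β I i c - M.β J i c) = (1 - M'.η i) * (M.β I i c - M.β J i c) := by
    linarith
  linarith [mul_right_cancel₀ (sub_ne_zero.2 hne) h3]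

end ProcurementModel

theorem lemma1 {ι : Type*} [DecidableEq ι] (uHi : ℝ) (M M' : ProcurementModel ι uHi)
    (hentry : ∀ i, 0 < M.entryProb i) (hvaries : M.ConfigVaries)
    (hdata : M.dataLaw = M'.dataLaw) :
    (∀ i, M.F i = M'.F i) ∧ (∀ i, M.η i = M'.η i) ∧ M.Fu = M'.Fu := by
  obtain ⟨I, J, hIJ, hIpos, hJpos⟩ := hvaries
  have hsupp : ∀ {K}, K ∈ M.config.support → K ∈ M'.config.support := fun hK =>
    ProcurementModel.mem_support_of_dataLaw_eq hdata hK
  have hbid : ∀ {K}, K ∈ M.config.support → M.bidLaw K = M'.bidLaw K := fun hK =>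
    ProcurementModel.bidLaw_eq_of_dataLaw_eq hdata hK
  have hlaw : ∀ {K}, K ∈ M.config.support →
      ∀ j ∈ K, M.homogeneousBidLaw K j = M'.homogeneousBidLaw K j := fun hK j hj =>
    ProcurementModel.homogeneousBidLaw_eq hK (hsupp hK) (hbid hK) hj
  have hI : I ∈ M.config.support := (PMF.mem_support_iff _ _).2 hIpos.ne'
  have hJ : J ∈ M.config.support := (PMF.mem_support_iff _ _).2 hJpos.ne'
  have hInonempty : I.Nonempty := Finset.card_pos.1 (by linarith [M.two_le_card I hI])
  obtain ⟨i, hi, c, hc, hne⟩ := (M.equilibrium I hI).exists_ne_of_ssubset (M.equilibrium J hJ)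
    M.F_density (fun i => (M.η_mem i).2) hIJ hInonempty
  have hηi := ProcurementModel.η_eq_of_β_ne hI (hsupp hI) hJ (hsupp hJ) (hlaw hI) (hlaw hJ) hi
    (hIJ.1 hi) hc hne
  have hFi := ProcurementModel.F_eq_of_η_eq hI (hsupp hI) (hlaw hI) hi hηi
  have hlo : M.lo = M'.lo := (M.F_density i).left_endpoint_eq (hFi ▸ M'.F_density i)
  -- One bidder has revealed the common lowest cost, and with it the other bidders are identified.
  have hall : ∀ k, M.F k = M'.F k ∧ M.η k = M'.η k := by
    intro k
    obtain ⟨K, hK, hkK⟩ : ∃ K ∈ M.config.support, k ∈ K := by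
      have hk := (hentry k).ne'
      rw [ProcurementModel.entryProb, Ne, PMF.toOuterMeasure_apply_eq_zero_iff,
        Set.not_disjoint_iff] at hk
      exact hk
    have hη := ProcurementModel.η_eq_of_lo_eq hK (hsupp hK) (hlaw hK) hkK hlo
    exact ⟨ProcurementModel.F_eq_of_η_eq hK (hsupp hK) (hlaw hK) hkK hη, hη⟩
  exact ⟨fun k => (hall k).1, fun k => (hall k).2, ProcurementModel.Fu_eq hI (hsupp hI) (hbid hI)⟩
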